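/- Let $\mathbf{A}$ be an abelian category. **Generalized morphisms.** A generalized morphism $\alpha\colon A\dashrightarrow B$ is a span $A\xleftarrow{\lambda}C\xrightarrow{\rho}B$; two spans are regarded as equal if the images of $(\lambda,\rho)\colon C\to A\oplus B$ agree as subobjects. Spans are composed by pullback (written $\alpha\cdot\beta$, first $\alpha$, then $\beta$), the pseudo-inverse $\alpha^{-1}$ is the swapped span, and a morphism $f\colon A\to B$ yields $[f]=(A\xleftarrow{\mathrm{id}}A\xrightarrow{f}B)$. Put $$\mathrm{dom}(\alpha)=\mathrm{im}\,\lambda,\quad \mathrm{gker}(\alpha)=\lambda(\ker\rho)\ \subseteq A,\qquad \mathrm{gim}(\alpha)=\mathrm{im}\,\rho,\quad \mathrm{def}(\alpha)=\rho(\ker\lambda)\ \subseteq B .$$ For subobjects $S\subseteq T\subseteq X$ with $\iota\colon T\hookrightarrow X$ and $\epsilon\colon T\twoheadrightarrow T/S$, let $\mathrm{emb}=[\epsilon]^{-1}\cdot[\iota]\colon T/S\dashrightarrow X$ and $\mathrm{proj}=[\iota]^{-1}\cdot[\epsilon]\colon X\dashrightarrow T/S$. **Data.** Let $(M^\bullet,\partial^\bullet)$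 be a cochain complex in $\mathbf{A}$ indexed by $\mathbb{Z}$, where each $M^i$ carries a chain of subobjects $F^jM^i\supseteq F^{j+1}M^i$ ($j\in\mathbb{Z}$) such that $\partial^i$ restricts to $F^jM^i\to F^jM^{i+1}$ for all $i,j$. Put $G^{p,q}:=F^pM^{p+q}/F^{p+1}M^{p+q}$ and, for $r\ge 0$ and $p,q\in\mathbb{Z}$, $$\partial_r^{p,q}:=\mathrm{emb}\cdot[\partial^{p+q}]\cdot\mathrm{proj}\colon\ G^{p,q}\dashrightarrow M^{p+q}\to M^{p+q+1}\dashrightarrow G^{p+r,\,q-(r-1)} .$$ One has $\mathrm{def}(\partial_r^{p-r,q+(r-1)})\subseteq\mathrm{gim}(\partial_r^{p-r,q+(r-1)})\subseteq\mathrm{gker}(\partial_r^{p,q})\subseteq\mathrm{dom}(\partial_r^{p,q})$, and we put $$E_r^{p,q}:=\mathrm{dom}(\partial_r^{p,q})/\mathrm{def}(\partial_r^{p-r,\,q+(r-1)}) .$$ **Claim.** These objects form a cohomological spectral sequence starting at page $0$, with the differentials described below. In detail: 1. $\mathrm{dom}(\partial_0^{p,q})=G^{p,q}$ and $\mathrm{def}(\partial_0^{p,q-1})=0$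 for all $p,q$, so that $E_0^{p,q}$ is $G^{p,q}$. 2. For all $r\ge 0$ and $p,q\in\mathbb{Z}$ there is a morphism $d_r^{p,q}\colon E_r^{p,q}\to E_r^{p+r,\,q-(r-1)}$ in $\mathbf{A}$ such that $[d_r^{p,q}]$ is the composite $$E_r^{p,q}\overset{\mathrm{emb}}{\dashrightarrow}M^{p+q}\xrightarrow{\ \partial^{p+q}\ }M^{p+q+1}\overset{\mathrm{proj}}{\dashrightarrow}E_r^{p+r,\,q-(r-1)},$$ where $\mathrm{emb}$ and $\mathrm{proj}$ are the subquotient embedding and projection, taken through $G^{p,q}$ and $G^{p+r,q-(r-1)}$ respectively. It arises from $\partial_r^{p,q}$ by the generalized homomorphism theorem: there is an isomorphism $\widetilde{\partial}\colon\mathrm{dom}(\partial_r^{p,q})/\mathrm{gker}(\partial_r^{p,q})\to\mathrm{gim}(\partial_r^{p,q})/\mathrm{def}(\partial_r^{p,q})$ with $\partial_r^{p,q}=\mathrm{proj}\cdot[\widetilde{\partial}]\cdot\mathrm{emb}$, and $d_r^{p,q}$ is the composite $$E_r^{p,q}\twoheadrightarrow \frac{\mathrm{dom}(\partial_r^{p,q})}{\mathrm{gker}(\partial_r^{p,q})}\xrightarrow{\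 \widetilde{\partial}\ }\frac{\mathrm{gim}(\partial_r^{p,q})}{\mathrm{def}(\partial_r^{p,q})}\hookrightarrow E_r^{p+r,\,q-(r-1)} .$$ 3. $d_r^{p+r,\,q-(r-1)}\circ d_r^{p,q}=0$. 4. There are isomorphisms $E_{r+1}^{p,q}\cong \ker(d_r^{p,q})/\mathrm{im}(d_r^{p-r,\,q+(r-1)})$, and they are compatible with the generalized embeddings of both sides into $G^{p,q}$ (the right-hand side being embedded as a subquotient of $E_r^{p,q}$). -/

import Mathlib

open CategoryTheory CategoryTheory.Limits

universe v u

/-- A generalized morphism from `A` to `B`: a span `A ⟵ apex ⟶ B`. Two generalized morphisms are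
regarded as equal when they are stably equivalent, see `GenMor.StableEquiv`. -/
structure GenMor {C : Type u} [Category.{v} C] (A B : C) where
  /-- the apex of the span -/
  apex : C
  /-- the left leg -/
  l : apex ⟶ A
  /-- the right leg -/
  r : apex ⟶ B

namespace GenMor

section

variable {C : Type u} [Category.{v} C]

/-- The generalized morphism `[f]` of a morphism `f`. -/
def ofHom {A B : C} (f : A ⟶ B) : GenMor A B := ⟨A, 𝟙 A, f⟩

/-- The pseudo-inverse. -/
def pinv {A B : C} (S : GenMor A B) : GenMor B A := ⟨S.apex, S.r, S.l⟩

/-- The generalized elements `a` of `A` and `b` of `B` are related by an element of the apex. -/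
def Related {A B : C} (S : GenMor A B) {W : C} (a : W ⟶ A) (b : W ⟶ B) : Prop :=
  ∃ w : W ⟶ S.apex, w ≫ S.l = a ∧ w ≫ S.r = b

theorem related_self {A B : C} (S : GenMor A B) : S.Related S.l S.r :=
  ⟨𝟙 _, Category.id_comp _, Category.id_comp _⟩

theorem related_ofHom {A B : C} (f : A ⟶ B) {W : C} (a : W ⟶ A) (b : W ⟶ B) :
    (ofHom f).Related a b ↔ a ≫ f = b := by
  constructor
  · rintro ⟨w, rfl, rfl⟩
    exact Category.assoc _ _ _ |>.trans (congrArg (w ≫ ·) (Category.id_comp f))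
  · intro h
    exact ⟨a, Category.comp_id a, h⟩

theorem related_pinv {A B : C} (S : GenMor A B) {W : C} (a : W ⟶ A) (b : W ⟶ B) :
    S.pinv.Related b a ↔ S.Related a b :=
  ⟨fun ⟨w, h, h'⟩ => ⟨w, h', h⟩, fun ⟨w, h, h'⟩ => ⟨w, h', h⟩⟩

end

section

variable {C : Type u} [Category.{v} C] [Abelian C]

/-- The associated relation of a span: the image of `(l, r) : apex ⟶ A ⊞ B`. -/
noncomputable def relation {A B : C} (S : GenMor A B) : Subobject (A ⊞ B) :=
  imageSubobject (biprod.lift S.l S.r)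

/-- Equality of generalized morphisms: the associated relations agree as subobjects. -/
def StableEquiv {A B : C} (S T : GenMor A B) : Prop :=
  S.relation = T.relation

/-- Composition of spans by pullback (in diagrammatic order). -/
noncomputable def comp {A B D : C} (S : GenMor A B) (T : GenMor B D) : GenMor A D :=
  ⟨pullback S.r T.l, pullback.fst S.r T.l ≫ S.l, pullback.snd S.r T.l ≫ T.r⟩

/-- The domain `im l`. -/
noncomputable def dom {A B : C} (S : GenMor A B) : Subobject A :=
  imageSubobject S.l

/-- The generalized kernel `l (ker r)`. -/
noncomputable def gker {A B : C} (S : GenMor A B) : Subobject A :=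
  imageSubobject ((kernelSubobject S.r).arrow ≫ S.l)

/-- The generalized image `im r`. -/
noncomputable def gim {A B : C} (S : GenMor A B) : Subobject B :=
  imageSubobject S.r

/-- The defect `r (ker l)`. -/
noncomputable def defect {A B : C} (S : GenMor A B) : Subobject B :=
  imageSubobject ((kernelSubobject S.l).arrow ≫ S.r)

theorem gker_le_dom {A B : C} (S : GenMor A B) : S.gker ≤ S.dom :=
  imageSubobject_comp_le _ _

theorem defect_le_gim {A B : C} (S : GenMor A B) : S.defect ≤ S.gim :=
  imageSubobject_comp_le _ _

theorem related_comp {A B D : C} (S : GenMor A B) (T : GenMor B D) {W : C}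
    (a : W ⟶ A) (c : W ⟶ D) :
    (S.comp T).Related a c ↔ ∃ b : W ⟶ B, S.Related a b ∧ T.Related b c := by
  constructor
  · rintro ⟨w, rfl, rfl⟩
    change W ⟶ pullback S.r T.l at w
    refine ⟨(w ≫ pullback.fst _ _) ≫ S.r, ⟨w ≫ pullback.fst _ _, ?_, rfl⟩,
      ⟨w ≫ pullback.snd _ _, ?_, ?_⟩⟩
    · exact Category.assoc _ _ _
    · rw [Category.assoc, Category.assoc, pullback.condition]
    · exact Category.assoc _ _ _
  · rintro ⟨_, ⟨s, rfl, rfl⟩, ⟨t, h, rfl⟩⟩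
    refine ⟨pullback.lift s t h.symm, ?_, ?_⟩
    · exact (Category.assoc _ _ _).symm.trans (congrArg (· ≫ S.l) (pullback.lift_fst _ _ _))
    · exact (Category.assoc _ _ _).symm.trans (congrArg (· ≫ T.r) (pullback.lift_snd _ _ _))

theorem gim_le_gker {A B D : C} (S : GenMor A B) (T : GenMor B D)
    (h : ∀ {W : C} (a : W ⟶ A) (b : W ⟶ B), S.Related a b → T.Related b (0 : W ⟶ D)) :
    S.gim ≤ T.gker := by
  obtain ⟨f, hl, hr⟩ := h _ _ S.related_self
  unfold gim gker
  refine imageSubobject_le _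
    (factorThruKernelSubobject T.r f hr ≫
      factorThruImageSubobject ((kernelSubobject T.r).arrow ≫ T.l)) ?_
  rw [Category.assoc, imageSubobject_arrow_comp, ← Category.assoc,
    factorThruKernelSubobject_comp_arrow, hl]

end

end GenMor

namespace SubQuot

section

variable {C : Type u} [Category.{v} C] [Abelian C]

/-- The subquotient `T / S` of `X` for subobjects `S ≤ T` of `X`. -/
noncomputable def obj {X : C} {S T : Subobject X} (h : S ≤ T) : C :=
  cokernel (Subobject.ofLE S T h)

/-- The projection `T ↠ T / S`. -/
noncomputable def π {X : C} {S T : Subobject X} (h : S ≤ T) : (T : C) ⟶ obj h :=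
  cokernel.π (Subobject.ofLE S T h)

/-- The generalized subquotient embedding `T / S ↞ T ↪ X`. -/
noncomputable def emb {X : C} {S T : Subobject X} (h : S ≤ T) : GenMor (obj h) X :=
  (GenMor.ofHom (π h)).pinv.comp (GenMor.ofHom T.arrow)

/-- The generalized subquotient projection `X ↩ T ↠ T / S`. -/
noncomputable def proj {X : C} {S T : Subobject X} (h : S ≤ T) : GenMor X (obj h) :=
  (GenMor.ofHom T.arrow).pinv.comp (GenMor.ofHom (π h))

theorem related_emb {X : C} {S T : Subobject X} (h : S ≤ T) {W : C} (a : W ⟶ obj h)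
    (x : W ⟶ X) : (emb h).Related a x ↔ ∃ b : W ⟶ (T : C), b ≫ π h = a ∧ b ≫ T.arrow = x := by
  simp only [emb, GenMor.related_comp, GenMor.related_pinv, GenMor.related_ofHom]

theorem related_proj {X : C} {S T : Subobject X} (h : S ≤ T) {W : C} (x : W ⟶ X)
    (a : W ⟶ obj h) :
    (proj h).Related x a ↔ ∃ b : W ⟶ (T : C), b ≫ T.arrow = x ∧ b ≫ π h = a := by
  simp only [proj, GenMor.related_comp, GenMor.related_pinv, GenMor.related_ofHom]

/-- The morphism `T / S ⟶ T' / S'` induced by inclusions `T ≤ T'` and `S ≤ S'`. -/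
noncomputable def map {X : C} {S T S' T' : Subobject X} (h : S ≤ T) (h' : S' ≤ T')
    (hS : S ≤ S') (hT : T ≤ T') : obj h ⟶ obj h' :=
  cokernel.map _ _ (Subobject.ofLE S S' hS) (Subobject.ofLE T T' hT) (by simp)

end

end SubQuot

/-- A filtered cochain complex: a `ℤ`-indexed cochain complex `M` each of whose objects carries a
descending `ℤ`-indexed chain of subobjects, compatible with the differentials. -/
structure FilteredCochainComplex (C : Type u) [Category.{v} C] [Abelian C] where
  /-- the underlying cochain complex -/
  M : CochainComplex C ℤ
  /-- `F j i` is the `j`-th step of the filtration of `M.X i` -/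
  F : ℤ → ∀ i : ℤ, Subobject (M.X i)
  le_succ : ∀ j i : ℤ, F (j + 1) i ≤ F j i
  compat : ∀ j i : ℤ, (F j (i + 1)).Factors ((F j i).arrow ≫ M.d i (i + 1))

namespace FilteredCochainComplex

section

variable {C : Type u} [Category.{v} C] [Abelian C] (K : FilteredCochainComplex C)

/-- The graded part `F^p M^{p+q} / F^{p+1} M^{p+q}`. -/
noncomputable abbrev gr (p q : ℤ) : C := SubQuot.obj (K.le_succ p (p + q))

/-- The generalized subquotient embedding of `gr p q` into `M^{p+q}`. -/
noncomputable def emb (p q : ℤ) : GenMor (K.gr p q) (K.M.X (p + q)) :=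
  SubQuot.emb (K.le_succ p (p + q))

/-- The generalized subquotient projection of `M^{p+q}` onto `gr p q`. -/
noncomputable def proj (p q : ℤ) : GenMor (K.M.X (p + q)) (K.gr p q) :=
  SubQuot.proj (K.le_succ p (p + q))

/-- The generalized morphism `emb · [∂] · proj` from `gr p q` to `gr p' q'`, for total degrees
with `p' + q' = p + q + 1`. Source and target are kept independent here, so that no transport
along equations between indices is needed. -/
noncomputable def genD (p q p' q' : ℤ) : GenMor (K.gr p q) (K.gr p' q') :=
  ((K.emb p q).comp (GenMor.ofHom (K.M.d (p + q) (p' + q')))).comp (K.proj p' q')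

/-- The generalized differential `∂_r^{p,q}`, going out of position `(p, q)`. -/
noncomputable def del (r p q : ℤ) : GenMor (K.gr p q) (K.gr (p + r) (q - (r - 1))) :=
  K.genD p q (p + r) (q - (r - 1))

/-- The generalized differential `∂_r^{p-r,q+(r-1)}`, going into position `(p, q)`. -/
noncomputable def delIn (r p q : ℤ) : GenMor (K.gr (p - r) (q + (r - 1))) (K.gr p q) :=
  K.genD (p - r) (q + (r - 1)) p q

/-- Consecutive generalized differentials form a generalized cochain complex. -/
theorem gim_genD_le_gker_genD (p q p' q' p'' q'' : ℤ) :
    (K.genD p q p' q').gim ≤ (K.genD p' q' p'' q'').gker := by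
  refine GenMor.gim_le_gker _ _ fun _ _ h => ?_
  obtain ⟨_, h₁, h₂⟩ := (GenMor.related_comp _ _ _ _).1 h
  obtain ⟨a, -, h₁⟩ := (GenMor.related_comp _ _ _ _).1 h₁
  obtain rfl := (GenMor.related_ofHom _ _ _).1 h₁
  rw [proj, SubQuot.related_proj] at h₂
  obtain ⟨b, hb, hbr⟩ := h₂
  refine (GenMor.related_comp _ _ _ _).2 ⟨0, (GenMor.related_comp _ _ _ _).2
    ⟨b ≫ (K.F p' (p' + q')).arrow, (SubQuot.related_emb _ _ _).2 ⟨b, hbr, rfl⟩,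
      (GenMor.related_ofHom _ _ _).2 ?_⟩, (SubQuot.related_proj _ _ _).2 ⟨0, zero_comp, zero_comp⟩⟩
  rw [hb, Category.assoc, K.M.d_comp_d, comp_zero]

theorem delIn_gim_le_del_gker (r p q : ℤ) : (K.delIn r p q).gim ≤ (K.del r p q).gker :=
  K.gim_genD_le_gker_genD _ _ _ _ _ _

theorem delIn_defect_le_del_gker (r p q : ℤ) : (K.delIn r p q).defect ≤ (K.del r p q).gker :=
  (K.delIn r p q).defect_le_gim.trans (K.delIn_gim_le_del_gker r p q)

theorem delIn_defect_le_del_dom (r p q : ℤ) : (K.delIn r p q).defect ≤ (K.del r p q).dom :=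
  (K.delIn_defect_le_del_gker r p q).trans (K.del r p q).gker_le_dom

theorem genD_defect_congr {p q p₁ q₁ : ℤ} (p' q' : ℤ) (hp : p = p₁) (hq : q = q₁) :
    (K.genD p q p' q').defect = (K.genD p₁ q₁ p' q').defect := by
  subst hp hq
  rfl

/-- The object `E_r^{p,q} = dom(∂_r^{p,q}) / def(∂_r^{p-r,q+(r-1)})`. -/
noncomputable abbrev page (r p q : ℤ) : C := SubQuot.obj (K.delIn_defect_le_del_dom r p q)

/-- `E_r^{p,q}` as a generalized subobject of `gr p q`. -/
noncomputable def pageEmbGr (r p q : ℤ) : GenMor (K.page r p q) (K.gr p q) :=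
  SubQuot.emb (K.delIn_defect_le_del_dom r p q)

/-- The generalized subquotient projection of `gr p q` onto `E_r^{p,q}`. -/
noncomputable def pageProjGr (r p q : ℤ) : GenMor (K.gr p q) (K.page r p q) :=
  SubQuot.proj (K.delIn_defect_le_del_dom r p q)

/-- The generalized subquotient embedding of `E_r^{p,q}` into `M^{p+q}`. -/
noncomputable def pageEmb (r p q : ℤ) : GenMor (K.page r p q) (K.M.X (p + q)) :=
  (K.pageEmbGr r p q).comp (K.emb p q)

/-- The generalized subquotient projection of `M^{p+q}` onto `E_r^{p,q}`. -/
noncomputable def pageProj (r p q : ℤ) : GenMor (K.M.X (p + q)) (K.page r p q) :=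
  (K.proj p q).comp (K.pageProjGr r p q)

/-- The projection `E_r^{p,q} ↠ dom(∂_r^{p,q}) / gker(∂_r^{p,q})`. -/
noncomputable def pageToCoim (r p q : ℤ) :
    K.page r p q ⟶ SubQuot.obj (K.del r p q).gker_le_dom :=
  SubQuot.map _ _ (K.delIn_defect_le_del_gker r p q) le_rfl

/-- The inclusion `gim(∂_r^{p,q}) / def(∂_r^{p,q}) ↪ E_r^{p+r,q-(r-1)}`. -/
noncomputable def imToPage (r p q : ℤ) :
    SubQuot.obj (K.del r p q).defect_le_gim ⟶ K.page r (p + r) (q - (r - 1)) :=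
  SubQuot.map _ _ (K.genD_defect_congr _ _ (by ring) (by ring)).le
    ((K.gim_genD_le_gker_genD _ _ _ _ _ _).trans (GenMor.gker_le_dom _))

/-- The generalized morphism `emb · [∂] · proj` from `E_r^{p,q}` to `E_r^{p+r,q-(r-1)}`. -/
noncomputable def pageDel (r p q : ℤ) :
    GenMor (K.page r p q) (K.page r (p + r) (q - (r - 1))) :=
  ((K.pageEmb r p q).comp (GenMor.ofHom (K.M.d (p + q) (p + r + (q - (r - 1)))))).comp
    (K.pageProj r (p + r) (q - (r - 1)))

end

end FilteredCochainComplex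

/-- The homology of a complex as a generalized subobject `H ↞ Z ↪ X` of its objects. -/
noncomputable def homologyEmb {C : Type u} [Category.{v} C] [Abelian C] {κ : Type*}
    {c : ComplexShape κ} (P : HomologicalComplex C c) (k : κ) : GenMor (P.homology k) (P.X k) :=
  (GenMor.ofHom (P.homologyπ k)).pinv.comp (GenMor.ofHom (P.iCycles k))

/-! A generalized morphism is determined by the relation it induces on generalized elements,
provided elements may be pulled back along epimorphisms. In these terms subquotients, generalized
kernels and defects are computed as for modules. A generalized morphism `R` induces a morphism
`T / S ⟶ T' / S'` whenever `S ≤ gker R`, `T ≤ dom R`, `def R ≤ S'` and `gim R ≤ T'`; applied to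
`∂_r^{p,q}` this is the differential `d_r^{p,q}`.

Since `proj` has domain `F^p` and generalized kernel `F^{p+1}`, the generalized kernel of `∂_r` is
the domain of `∂_{r+1}`, and dually the generalized image of the incoming `∂_r` is the defect of
the incoming `∂_{r+1}`. Hence the homology of `E_r` and `E_{r+1}` both embed into the graded part
with the same generalized image and the same defect, and a generalized embedding is determined by
these up to isomorphism.
-/

section Subobject

theorem factors_epi_comp_iff {C : Type u} [Category.{v} C] [StrongEpiCategory C] {X W W' : C}
    (S : Subobject X) (π : W' ⟶ W) [Epi π] (x : W ⟶ X) : S.Factors (π ≫ x) ↔ S.Factors x := by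
  refine ⟨fun h => ?_, S.factors_of_factors_right π⟩
  have := strongEpi_of_epi π
  have sq : CommSq (S.factorThru _ h) π S.arrow x := ⟨S.factorThru_arrow _ h⟩
  exact (S.factors_iff x).2 ⟨sq.lift, sq.fac_right⟩

theorem subobject_ext_of_factors_iff {C : Type u} [Category.{v} C] {X : C} {S T : Subobject X}
    (h : ∀ {W : C} (x : W ⟶ X), S.Factors x ↔ T.Factors x) : S = T :=
  le_antisymm (Subobject.le_of_factors ((h _).1 S.factors_self))
    (Subobject.le_of_factors ((h _).2 T.factors_self))

variable {C : Type u} [Category.{v} C] [Abelian C]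

theorem imageSubobject_factors_iff {X Y W : C} (f : X ⟶ Y) (y : W ⟶ Y) :
    (imageSubobject f).Factors y ↔
      ∃ (W' : C) (π : W' ⟶ W) (_ : Epi π) (x : W' ⟶ X), π ≫ y = x ≫ f := by
  constructor
  · intro h
    obtain ⟨W', π, hπ, x, hx⟩ := surjective_up_to_refinements_of_epi
      (factorThruImageSubobject f) ((imageSubobject f).factorThru y h)
    exact ⟨W', π, hπ, x, by simpa using congrArg (· ≫ (imageSubobject f).arrow) hx⟩
  · rintro ⟨W', π, _, x, hx⟩
    rw [← factors_epi_comp_iff _ π, hx]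
    exact imageSubobject_factors_comp_self f x

/-- The isomorphism between two quotients of an object that have the same kernel. -/
noncomputable def quotientIso {Z A B : C} (f : Z ⟶ A) (g : Z ⟶ B) [Epi f] [Epi g]
    (h : kernelSubobject f = kernelSubobject g) : A ≅ B where
  hom := Abelian.epiDesc f g <| (kernelSubobject_factors_iff g _).1 <|
    h ▸ kernelSubobject_factors f _ (kernel.condition f)
  inv := Abelian.epiDesc g f <| (kernelSubobject_factors_iff f _).1 <|
    h ▸ kernelSubobject_factors g _ (kernel.condition g)
  hom_inv_id := by simp [← cancel_epi f]
  inv_hom_id := by simp [← cancel_epi g]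

theorem comp_quotientIso_hom {Z A B : C} (f : Z ⟶ A) (g : Z ⟶ B) [Epi f] [Epi g]
    (h : kernelSubobject f = kernelSubobject g) : f ≫ (quotientIso f g h).hom = g :=
  Abelian.comp_epiDesc _ _ _

end Subobject

namespace GenMor

section

variable {C : Type u} [Category.{v} C] {A B : C} {S : GenMor A B} {W W' : C} {a : W ⟶ A} {b : W ⟶ B}

theorem Related.precomp (h : S.Related a b) (f : W' ⟶ W) : S.Related (f ≫ a) (f ≫ b) := by
  obtain ⟨w, rfl, rfl⟩ := h
  exact ⟨f ≫ w, Category.assoc _ _ _, Category.assoc _ _ _⟩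

/-- Two generalized elements are locally related by a generalized morphism if they are related
after pullback along an epimorphism. Unlike `GenMor.Related`, this depends only on the stable
equivalence class of the generalized morphism. -/
def LocRelated (S : GenMor A B) (a : W ⟶ A) (b : W ⟶ B) : Prop :=
  ∃ (W' : C) (π : W' ⟶ W) (_ : Epi π), S.Related (π ≫ a) (π ≫ b)

theorem Related.locRelated (h : S.Related a b) : S.LocRelated a b :=
  ⟨W, 𝟙 W, inferInstance, h.precomp _⟩

theorem locRelated_pinv : S.pinv.LocRelated b a ↔ S.LocRelated a b := by
  simp only [LocRelated, related_pinv]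

theorem locRelated_ofHom {f : A ⟶ B} : (ofHom f).LocRelated a b ↔ a ≫ f = b := by
  refine ⟨fun ⟨W', π, _, h⟩ => ?_, fun h => ((related_ofHom f a b).2 h).locRelated⟩
  rw [related_ofHom, Category.assoc] at h
  exact (cancel_epi π).1 h

end

section

variable {C : Type u} [Category.{v} C] [Abelian C] {A B D X : C} {W : C}

theorem relation_factors_iff {S : GenMor A B} {a : W ⟶ A} {b : W ⟶ B} :
    S.relation.Factors (biprod.lift a b) ↔ S.LocRelated a b := by
  rw [relation, imageSubobject_factors_iff]
  refine exists_congr fun W' => exists_congr fun π => exists_congr fun _ => exists_congr fun w => ?_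
  simp [biprod.hom_ext_iff, eq_comm]

theorem stableEquiv_iff {S T : GenMor A B} : S.StableEquiv T ↔
    ∀ {W : C} (a : W ⟶ A) (b : W ⟶ B), S.LocRelated a b ↔ T.LocRelated a b := by
  simp only [← relation_factors_iff]
  refine ⟨fun h W a b => by rw [h], fun h => subobject_ext_of_factors_iff fun x => ?_⟩
  have hx : x = biprod.lift (x ≫ biprod.fst) (x ≫ biprod.snd) := by ext <;> simp
  rw [hx, h]

theorem stableEquiv_of_related_iff {S T : GenMor A B}
    (h : ∀ {W : C} (a : W ⟶ A) (b : W ⟶ B), S.Related a b ↔ T.Related a b) : S.StableEquiv T :=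
  stableEquiv_iff.2 fun _ _ => by simp only [LocRelated, h]

theorem locRelated_epi_comp_iff {S : GenMor A B} {W' : C} (π : W' ⟶ W) [Epi π] {a : W ⟶ A}
    {b : W ⟶ B} : S.LocRelated (π ≫ a) (π ≫ b) ↔ S.LocRelated a b := by
  have h : biprod.lift (π ≫ a) (π ≫ b) = π ≫ biprod.lift a b := by ext <;> simp
  rw [← relation_factors_iff, ← relation_factors_iff, h, factors_epi_comp_iff]

theorem LocRelated.precomp {S : GenMor A B} {W' : C} {a : W ⟶ A} {b : W ⟶ B}
    (h : S.LocRelated a b) (f : W' ⟶ W) : S.LocRelated (f ≫ a) (f ≫ b) := by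
  have hf : biprod.lift (f ≫ a) (f ≫ b) = f ≫ biprod.lift a b := by ext <;> simp
  rw [← relation_factors_iff] at h ⊢
  exact hf ▸ Subobject.factors_of_factors_right f h

theorem LocRelated.sub {S : GenMor A B} {a a' : W ⟶ A} {b b' : W ⟶ B}
    (h : S.LocRelated a b) (h' : S.LocRelated a' b') : S.LocRelated (a - a') (b - b') := by
  have hsub : biprod.lift a' b' + biprod.lift (a - a') (b - b') = biprod.lift a b := by
    ext <;> simp
  rw [← relation_factors_iff] at h h' ⊢
  exact Subobject.factors_right_of_factors_add _ _ (hsub ▸ h) h'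

theorem locRelated_comp {S : GenMor A B} {T : GenMor B D} {a : W ⟶ A} {c : W ⟶ D} :
    (S.comp T).LocRelated a c ↔ ∃ (W' : C) (π : W' ⟶ W) (_ : Epi π) (b : W' ⟶ B),
      S.LocRelated (π ≫ a) b ∧ T.LocRelated b (π ≫ c) := by
  constructor
  · rintro ⟨W', π, hπ, h⟩
    obtain ⟨b, hab, hbc⟩ := (related_comp _ _ _ _).1 h
    exact ⟨W', π, hπ, b, hab.locRelated, hbc.locRelated⟩
  · rintro ⟨W₁, π, _, b, ⟨W₂, ρ, _, hab⟩, hbc⟩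
    obtain ⟨W₃, σ, _, hbc⟩ := hbc.precomp ρ
    rw [← locRelated_epi_comp_iff π, ← locRelated_epi_comp_iff ρ, ← locRelated_epi_comp_iff σ]
    exact ((related_comp _ _ _ _).2 ⟨_, hab.precomp σ, hbc⟩).locRelated

theorem locRelated_ofHom_comp {f : A ⟶ B} {T : GenMor B D} {a : W ⟶ A} {c : W ⟶ D} :
    ((ofHom f).comp T).LocRelated a c ↔ T.LocRelated (a ≫ f) c := by
  simp only [LocRelated, related_comp, related_ofHom, exists_eq_left', Category.assoc]

theorem StableEquiv.comp {S S' : GenMor A B} {T T' : GenMor B D}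
    (hS : S.StableEquiv S') (hT : T.StableEquiv T') : (S.comp T).StableEquiv (S'.comp T') := by
  rw [stableEquiv_iff] at hS hT ⊢
  simp only [locRelated_comp, hS, hT, implies_true]

theorem pinv_comp_stableEquiv (S : GenMor A B) (T : GenMor B D) :
    (S.comp T).pinv.StableEquiv (T.pinv.comp S.pinv) :=
  stableEquiv_of_related_iff fun _ _ => by simp only [related_pinv, related_comp, and_comm]

theorem comp_assoc_stableEquiv (S : GenMor A B) (T : GenMor B D) (U : GenMor D X) :
    ((S.comp T).comp U).StableEquiv (S.comp (T.comp U)) :=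
  stableEquiv_of_related_iff fun _ _ => by
    simp only [related_comp, ← exists_and_left, ← exists_and_right, and_assoc]
    exact exists_comm

theorem comp_ofHom_id_stableEquiv (S : GenMor A B) : (S.comp (ofHom (𝟙 B))).StableEquiv S :=
  stableEquiv_of_related_iff fun _ _ => by
    simp only [related_comp, related_ofHom, Category.comp_id, exists_eq_right]

theorem dom_factors_iff {S : GenMor A B} {a : W ⟶ A} : S.dom.Factors a ↔
    ∃ (W' : C) (π : W' ⟶ W) (_ : Epi π) (b : W' ⟶ B), S.LocRelated (π ≫ a) b := by
  rw [dom, imageSubobject_factors_iff]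
  constructor
  · rintro ⟨W', π, hπ, w, h⟩
    exact ⟨W', π, hπ, w ≫ S.r, (show S.Related _ _ from ⟨w, h.symm, rfl⟩).locRelated⟩
  · rintro ⟨W', π, _, b, V, ρ, _, w, h, -⟩
    exact ⟨V, ρ ≫ π, inferInstance, w, by rw [h, Category.assoc]⟩

theorem gker_factors_iff {S : GenMor A B} {a : W ⟶ A} : S.gker.Factors a ↔ S.LocRelated a 0 := by
  rw [gker, imageSubobject_factors_iff]
  refine exists_congr fun W' => exists_congr fun π => exists_congr fun _ => ⟨?_, ?_⟩
  · rintro ⟨w, h⟩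
    exact ⟨w ≫ (kernelSubobject S.r).arrow, by simp [h], by simp [kernelSubobject_arrow_comp]⟩
  · rintro ⟨w, h, h0⟩
    exact ⟨factorThruKernelSubobject S.r w (by simpa using h0), by
      rw [← Category.assoc, factorThruKernelSubobject_comp_arrow, h]⟩

theorem gim_factors_iff {S : GenMor A B} {b : W ⟶ B} : S.gim.Factors b ↔
    ∃ (W' : C) (π : W' ⟶ W) (_ : Epi π) (a : W' ⟶ A), S.LocRelated a (π ≫ b) :=
  (dom_factors_iff (S := S.pinv)).trans (by simp only [locRelated_pinv])

theorem defect_factors_iff {S : GenMor A B} {b : W ⟶ B} :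
    S.defect.Factors b ↔ S.LocRelated 0 b :=
  (gker_factors_iff (S := S.pinv)).trans locRelated_pinv

theorem LocRelated.dom_factors {S : GenMor A B} {a : W ⟶ A} {b : W ⟶ B} (h : S.LocRelated a b) :
    S.dom.Factors a :=
  dom_factors_iff.2 ⟨W, 𝟙 W, inferInstance, b, by rwa [Category.id_comp]⟩

theorem LocRelated.gim_factors {S : GenMor A B} {a : W ⟶ A} {b : W ⟶ B} (h : S.LocRelated a b) :
    S.gim.Factors b :=
  (locRelated_pinv.2 h).dom_factors

theorem LocRelated.locRelated_iff_defect_factors_sub {S : GenMor A B} {a : W ⟶ A} {b b' : W ⟶ B}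
    (h : S.LocRelated a b) : S.LocRelated a b' ↔ S.defect.Factors (b - b') := by
  rw [defect_factors_iff]
  exact ⟨fun h' => by simpa using h.sub h', fun h' => by simpa using h.sub h'⟩

theorem LocRelated.gker_factors_iff_defect_factors {S : GenMor A B} {a : W ⟶ A} {b : W ⟶ B}
    (h : S.LocRelated a b) : S.gker.Factors a ↔ S.defect.Factors b := by
  rw [gker_factors_iff, h.locRelated_iff_defect_factors_sub, sub_zero]

theorem StableEquiv.gim_eq {S T : GenMor A B} (h : S.StableEquiv T) : S.gim = T.gim :=
  subobject_ext_of_factors_iff fun _ => by simp only [gim_factors_iff, stableEquiv_iff.1 h]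

theorem StableEquiv.defect_eq {S T : GenMor A B} (h : S.StableEquiv T) : S.defect = T.defect :=
  subobject_ext_of_factors_iff fun _ => by simp only [defect_factors_iff, stableEquiv_iff.1 h]

theorem StableEquiv.pinv {S T : GenMor A B} (h : S.StableEquiv T) : S.pinv.StableEquiv T.pinv :=
  stableEquiv_iff.2 fun _ _ => by simp only [locRelated_pinv, stableEquiv_iff.1 h]

theorem gim_comp_factors_iff {S : GenMor A B} {T : GenMor B D} {c : W ⟶ D} :
    (S.comp T).gim.Factors c ↔ ∃ (W' : C) (π : W' ⟶ W) (_ : Epi π) (b : W' ⟶ B),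
      S.gim.Factors b ∧ T.LocRelated b (π ≫ c) := by
  simp only [gim_factors_iff, locRelated_comp]
  constructor
  · rintro ⟨W₁, π, _, a, W₂, ρ, _, b, hab, hbc⟩
    exact ⟨W₂, ρ ≫ π, inferInstance, b, ⟨W₂, 𝟙 W₂, inferInstance, _, by simpa using hab⟩,
      by simpa using hbc⟩
  · rintro ⟨W₁, π, _, b, ⟨W₂, ρ, _, a, hab⟩, hbc⟩
    exact ⟨W₂, ρ ≫ π, inferInstance, a, W₂, 𝟙 W₂, inferInstance, ρ ≫ b, by simpa using hab,
      by simpa using hbc.precomp ρ⟩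

theorem defect_comp_factors_iff {S : GenMor A B} {T : GenMor B D} {c : W ⟶ D} :
    (S.comp T).defect.Factors c ↔ ∃ (W' : C) (π : W' ⟶ W) (_ : Epi π) (b : W' ⟶ B),
      S.defect.Factors b ∧ T.LocRelated b (π ≫ c) := by
  simp only [defect_factors_iff, locRelated_comp, comp_zero]

theorem gim_comp_eq_defect_comp {A' : C} {S : GenMor A B} {S' : GenMor A' B} (T : GenMor B D)
    (h : S.gim = S'.defect) : (S.comp T).gim = (S'.comp T).defect :=
  subobject_ext_of_factors_iff fun _ => by rw [gim_comp_factors_iff, defect_comp_factors_iff, h]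

theorem gker_comp_eq_dom_comp {D' : C} (S : GenMor A B) {T : GenMor B D} {T' : GenMor B D'}
    (h : T.gker = T'.dom) : (S.comp T).gker = (S.comp T').dom := by
  have hST : (T.pinv.comp S.pinv).defect = (S.comp T).gker :=
    (pinv_comp_stableEquiv S T).defect_eq.symm
  have hST' : (T'.pinv.comp S.pinv).gim = (S.comp T').dom :=
    (pinv_comp_stableEquiv S T').gim_eq.symm
  rw [← hST, ← hST']
  exact (gim_comp_eq_defect_comp (S := T'.pinv) (S' := T.pinv) S.pinv h.symm).symm

theorem locRelated_pinv_ofHom_comp_ofHom_iff {Z : C} {e : Z ⟶ A} {m : Z ⟶ B} [Mono m] {a : W ⟶ A}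
    {b : W ⟶ B} : ((ofHom e).pinv.comp (ofHom m)).LocRelated a b ↔
      ∃ z : W ⟶ Z, z ≫ e = a ∧ z ≫ m = b := by
  have hrel {V : C} (a : V ⟶ A) (b : V ⟶ B) : ((ofHom e).pinv.comp (ofHom m)).Related a b ↔
      ∃ z : V ⟶ Z, z ≫ e = a ∧ z ≫ m = b := by
    simp only [related_comp, related_pinv, related_ofHom]
  refine ⟨fun ⟨W', π, _, h⟩ => ?_, fun h => ((hrel a b).2 h).locRelated⟩
  obtain ⟨w, hwe, hwm⟩ := (hrel _ _).1 h
  have := strongEpi_of_epi π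
  have sq : CommSq w π m b := ⟨hwm⟩
  refine ⟨sq.lift, ?_, sq.fac_right⟩
  rw [← cancel_epi π, ← hwe, ← Category.assoc, sq.fac_left]

end

end GenMor

namespace SubQuot

section

variable {C : Type u} [Category.{v} C] [Abelian C] {A X : C} {S T : Subobject X} {h : S ≤ T}
  {W : C}

instance epi_π : Epi (π h) :=
  inferInstanceAs (Epi (cokernel.π _))

theorem ofLE_comp_π : Subobject.ofLE S T h ≫ π h = 0 :=
  cokernel.condition _

theorem comp_π_eq_zero_iff {b : W ⟶ (T : C)} : b ≫ π h = 0 ↔ S.Factors (b ≫ T.arrow) := by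
  constructor
  · intro h0
    have hker : b ≫ cokernel.π (Subobject.ofLE S T h) = 0 := h0
    rw [← Abelian.monoLift_comp (Subobject.ofLE S T h) b hker, Category.assoc,
      Subobject.ofLE_arrow]
    exact Subobject.factors_comp_arrow _
  · intro hb
    have hS : b = S.factorThru _ hb ≫ Subobject.ofLE S T h := by simp [← cancel_mono T.arrow]
    rw [hS, Category.assoc, ofLE_comp_π, comp_zero]

theorem comp_π_eq_comp_π_iff {b b' : W ⟶ (T : C)} :
    b ≫ π h = b' ≫ π h ↔ S.Factors (b ≫ T.arrow - b' ≫ T.arrow) := by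
  rw [← sub_eq_zero, ← Preadditive.sub_comp, comp_π_eq_zero_iff, Preadditive.sub_comp]

theorem π_map {S' T' : Subobject X} (h : S ≤ T) (h' : S' ≤ T') (hS : S ≤ S') (hT : T ≤ T') :
    π h ≫ map h h' hS hT = Subobject.ofLE T T' hT ≫ π h' :=
  cokernel.π_desc _ _ _

theorem isIso_π_of_eq_bot (hS : S = ⊥) : IsIso (π h) := by
  have : Mono (π h) := Preadditive.mono_of_cancel_zero _ fun b hb => by
    rwa [comp_π_eq_zero_iff, hS, Subobject.bot_factors_iff_zero, ← zero_comp (f := T.arrow),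
      cancel_mono] at hb
  exact isIso_of_mono_of_epi _

theorem locRelated_emb {a : W ⟶ obj h} {x : W ⟶ X} :
    (emb h).LocRelated a x ↔ ∃ b : W ⟶ (T : C), b ≫ π h = a ∧ b ≫ T.arrow = x :=
  GenMor.locRelated_pinv_ofHom_comp_ofHom_iff

theorem locRelated_proj {x : W ⟶ X} {a : W ⟶ obj h} :
    (proj h).LocRelated x a ↔ ∃ b : W ⟶ (T : C), b ≫ π h = a ∧ b ≫ T.arrow = x := by
  have hpinv : (proj h).StableEquiv (emb h).pinv := GenMor.stableEquiv_of_related_iff fun _ _ => by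
    simp only [GenMor.related_pinv, related_proj, related_emb, and_comm]
  rw [GenMor.stableEquiv_iff.1 hpinv, GenMor.locRelated_pinv, locRelated_emb]

theorem gim_comp_emb_factors_iff {U : GenMor A (obj h)} {x : W ⟶ X} :
    (U.comp (emb h)).gim.Factors x ↔
      ∃ b : W ⟶ (T : C), b ≫ T.arrow = x ∧ U.gim.Factors (b ≫ π h) := by
  rw [GenMor.gim_comp_factors_iff]
  constructor
  · rintro ⟨W', ρ, _, _, hU, hemb⟩
    obtain ⟨b, rfl, hb⟩ := locRelated_emb.1 hemb
    have := strongEpi_of_epi ρ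
    have sq : CommSq b ρ T.arrow x := ⟨hb⟩
    refine ⟨sq.lift, sq.fac_right, ?_⟩
    rwa [← factors_epi_comp_iff _ ρ, ← Category.assoc, sq.fac_left]
  · rintro ⟨b, rfl, hU⟩
    exact ⟨W, 𝟙 W, inferInstance, _, hU, locRelated_emb.2 ⟨b, rfl, (Category.id_comp _).symm⟩⟩

theorem gim_comp_emb_eq {U : GenMor A (obj h)} {R : Subobject X} (hR : R ≤ T)
    (hU : ∀ {W : C} (b : W ⟶ (T : C)), U.gim.Factors (b ≫ π h) ↔ R.Factors (b ≫ T.arrow)) :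
    (U.comp (emb h)).gim = R :=
  subobject_ext_of_factors_iff fun x => by
    simp only [gim_comp_emb_factors_iff, hU]
    refine ⟨fun ⟨_, hb, hbR⟩ => hb ▸ hbR, fun hx => ?_⟩
    have hT := T.factorThru_arrow x (Subobject.factors_of_le x hR hx)
    exact ⟨_, hT, hT.symm ▸ hx⟩

end

end SubQuot

namespace GenMor

section

variable {C : Type u} [Category.{v} C] [Abelian C] {A B W : C} (R : GenMor A B)

/-- The epimorphism from the apex of a generalized morphism onto its domain. -/
noncomputable def toDom : R.apex ⟶ (R.dom : C) :=
  factorThruImageSubobject R.l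

/-- The epimorphism from the apex of a generalized morphism onto its generalized image. -/
noncomputable def toGim : R.apex ⟶ (R.gim : C) :=
  factorThruImageSubobject R.r

instance epi_toDom : Epi R.toDom :=
  inferInstanceAs (Epi (factorThruImageSubobject _))

instance epi_toGim : Epi R.toGim :=
  inferInstanceAs (Epi (factorThruImageSubobject _))

theorem toDom_arrow : R.toDom ≫ R.dom.arrow = R.l :=
  imageSubobject_arrow_comp _

theorem toGim_arrow : R.toGim ≫ R.gim.arrow = R.r :=
  imageSubobject_arrow_comp _

theorem kernelSubobject_toDom_comp_π :
    kernelSubobject (R.toDom ≫ SubQuot.π R.gker_le_dom) =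
      kernelSubobject (R.toGim ≫ SubQuot.π R.defect_le_gim) :=
  subobject_ext_of_factors_iff fun w => by
    rw [kernelSubobject_factors_iff, kernelSubobject_factors_iff, ← Category.assoc,
      ← Category.assoc, SubQuot.comp_π_eq_zero_iff, SubQuot.comp_π_eq_zero_iff, Category.assoc,
      Category.assoc, toDom_arrow, toGim_arrow]
    exact (R.related_self.precomp w).locRelated.gker_factors_iff_defect_factors

/-- The isomorphism of the generalized homomorphism theorem: both sides are the quotient of the
apex by the same subobject. -/
noncomputable def coimageIsoImage :
    SubQuot.obj R.gker_le_dom ≅ SubQuot.obj R.defect_le_gim :=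
  quotientIso (R.toDom ≫ SubQuot.π R.gker_le_dom) (R.toGim ≫ SubQuot.π R.defect_le_gim)
    R.kernelSubobject_toDom_comp_π

theorem toDom_comp_coimageIsoImage_hom :
    R.toDom ≫ SubQuot.π R.gker_le_dom ≫ R.coimageIsoImage.hom =
      R.toGim ≫ SubQuot.π R.defect_le_gim :=
  (Category.assoc _ _ _).symm.trans (comp_quotientIso_hom _ _ _)

variable {R}

theorem comp_coimageIsoImage_hom_iff {u : W ⟶ (R.dom : C)} {v : W ⟶ (R.gim : C)} :
    u ≫ SubQuot.π R.gker_le_dom ≫ R.coimageIsoImage.hom = v ≫ SubQuot.π R.defect_le_gim ↔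
      R.LocRelated (u ≫ R.dom.arrow) (v ≫ R.gim.arrow) := by
  obtain ⟨W', ρ, _, w, hw⟩ := surjective_up_to_refinements_of_epi R.toDom u
  have hrel : R.LocRelated (ρ ≫ u ≫ R.dom.arrow) (w ≫ R.toGim ≫ R.gim.arrow) := by
    rw [← Category.assoc ρ u, hw, Category.assoc, toDom_arrow, toGim_arrow]
    exact (R.related_self.precomp w).locRelated
  rw [← locRelated_epi_comp_iff ρ, hrel.locRelated_iff_defect_factors_sub, ← cancel_epi ρ,
    ← Category.assoc ρ u, hw, Category.assoc, toDom_comp_coimageIsoImage_hom,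
    ← Category.assoc, ← Category.assoc, SubQuot.comp_π_eq_comp_π_iff]
  simp only [Category.assoc]

theorem locRelated_iff_exists_comp_coimageIsoImage {a : W ⟶ A} {b : W ⟶ B} :
    R.LocRelated a b ↔ ∃ (u : W ⟶ (R.dom : C)) (v : W ⟶ (R.gim : C)), u ≫ R.dom.arrow = a ∧
      v ≫ R.gim.arrow = b ∧
      u ≫ SubQuot.π R.gker_le_dom ≫ R.coimageIsoImage.hom = v ≫ SubQuot.π R.defect_le_gim := by
  constructor
  · intro h
    refine ⟨R.dom.factorThru a h.dom_factors, R.gim.factorThru b h.gim_factors,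
      R.dom.factorThru_arrow _ _, R.gim.factorThru_arrow _ _, ?_⟩
    rwa [comp_coimageIsoImage_hom_iff, Subobject.factorThru_arrow, Subobject.factorThru_arrow]
  · rintro ⟨u, v, rfl, rfl, h⟩
    exact comp_coimageIsoImage_hom_iff.1 h

end

section

variable {C : Type u} [Category.{v} C] [Abelian C] {A B D W : C}

theorem coimageIsoImage_stableEquiv (R : GenMor A B) : R.StableEquiv
    (((SubQuot.proj R.gker_le_dom).comp (ofHom R.coimageIsoImage.hom)).comp
      (SubQuot.emb R.defect_le_gim)) := by
  have hrel {W : C} (a : W ⟶ A) (b : W ⟶ B) :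
      (((SubQuot.proj R.gker_le_dom).comp (ofHom R.coimageIsoImage.hom)).comp
        (SubQuot.emb R.defect_le_gim)).Related a b ↔ R.LocRelated a b := by
    simp only [related_comp, related_ofHom, SubQuot.related_proj, SubQuot.related_emb,
      locRelated_iff_exists_comp_coimageIsoImage]
    constructor
    · rintro ⟨_, ⟨_, ⟨u, rfl, rfl⟩, rfl⟩, v, hv, rfl⟩
      exact ⟨u, v, rfl, rfl, by rw [hv, Category.assoc]⟩
    · rintro ⟨u, v, rfl, rfl, h⟩
      exact ⟨_, ⟨_, ⟨u, rfl, rfl⟩, rfl⟩, v, by rw [← h, Category.assoc], rfl⟩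
  refine stableEquiv_iff.2 fun a b => ⟨fun h => ((hrel a b).2 h).locRelated, ?_⟩
  rintro ⟨W', π, _, h⟩
  exact (locRelated_epi_comp_iff π).1 ((hrel _ _).1 h)

/-- The morphism `T / S ⟶ T' / S'` of subquotients induced by a generalized morphism through its
generalized homomorphism theorem. -/
noncomputable def mapSubQuot (R : GenMor A B) {S T : Subobject A} {S' T' : Subobject B}
    (h : S ≤ T) (h' : S' ≤ T') (hS : S ≤ R.gker) (hT : T ≤ R.dom) (hS' : R.defect ≤ S')
    (hT' : R.gim ≤ T') : SubQuot.obj h ⟶ SubQuot.obj h' :=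
  SubQuot.map h R.gker_le_dom hS hT ≫ R.coimageIsoImage.hom ≫
    SubQuot.map R.defect_le_gim h' hS' hT'

theorem exists_locRelated_arrow {R : GenMor A B} {T : Subobject A} {T' : Subobject B}
    (hT : T ≤ R.dom) (hT' : R.gim ≤ T') (u : W ⟶ (T : C)) :
    ∃ (W' : C) (ρ : W' ⟶ W) (_ : Epi ρ) (v : W' ⟶ (T' : C)),
      R.LocRelated ((ρ ≫ u) ≫ T.arrow) (v ≫ T'.arrow) := by
  obtain ⟨W', ρ, hρ, b, hb⟩ :=
    dom_factors_iff.1 (Subobject.factors_of_le _ hT (Subobject.factors_comp_arrow u))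
  refine ⟨W', ρ, hρ, T'.factorThru b (Subobject.factors_of_le _ hT' hb.gim_factors), ?_⟩
  rwa [Subobject.factorThru_arrow, Category.assoc]

section

variable {R : GenMor A B} {S T : Subobject A} {S' T' : Subobject B} {h : S ≤ T} {h' : S' ≤ T'}
  {hS : S ≤ R.gker} {hT : T ≤ R.dom} {hS' : R.defect ≤ S'} {hT' : R.gim ≤ T'}

theorem LocRelated.comp_mapSubQuot {u : W ⟶ (T : C)} {v : W ⟶ (T' : C)}
    (huv : R.LocRelated (u ≫ T.arrow) (v ≫ T'.arrow)) :
    u ≫ SubQuot.π h ≫ R.mapSubQuot h h' hS hT hS' hT' = v ≫ SubQuot.π h' := by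
  obtain ⟨u₀, v₀, hu, hv, huv₀⟩ := locRelated_iff_exists_comp_coimageIsoImage.1 huv
  obtain rfl : u ≫ Subobject.ofLE T R.dom hT = u₀ := by simp [← cancel_mono R.dom.arrow, hu]
  obtain rfl : v₀ ≫ Subobject.ofLE R.gim T' hT' = v := by simp [← cancel_mono T'.arrow, hv]
  rw [Category.assoc, ← SubQuot.π_map R.defect_le_gim h' hS' hT', ← Category.assoc v₀, ← huv₀,
    mapSubQuot, ← Category.assoc (SubQuot.π h), SubQuot.π_map]
  simp only [Category.assoc]

theorem comp_mapSubQuot_iff (hd : S' ≤ R.defect) {u : W ⟶ (T : C)} {v : W ⟶ (T' : C)} :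
    u ≫ SubQuot.π h ≫ R.mapSubQuot h h' hS hT hS' hT' = v ≫ SubQuot.π h' ↔
      R.LocRelated (u ≫ T.arrow) (v ≫ T'.arrow) := by
  refine ⟨fun huv => ?_, LocRelated.comp_mapSubQuot⟩
  obtain ⟨W', ρ, _, v', hv'⟩ := exists_locRelated_arrow hT hT' u
  have hvv' : v' ≫ SubQuot.π h' = (ρ ≫ v) ≫ SubQuot.π h' :=
    calc v' ≫ SubQuot.π h' = (ρ ≫ u) ≫ SubQuot.π h ≫ R.mapSubQuot h h' hS hT hS' hT' :=
          hv'.comp_mapSubQuot.symm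
      _ = (ρ ≫ v) ≫ SubQuot.π h' := by rw [Category.assoc, huv, Category.assoc]
  rw [← locRelated_epi_comp_iff ρ, ← Category.assoc, ← Category.assoc,
    hv'.locRelated_iff_defect_factors_sub]
  exact Subobject.factors_of_le _ hd (SubQuot.comp_π_eq_comp_π_iff.1 hvv')

theorem comp_mapSubQuot_eq_zero_iff (hd : S' ≤ R.defect) {u : W ⟶ (T : C)} :
    u ≫ SubQuot.π h ≫ R.mapSubQuot h h' hS hT hS' hT' = 0 ↔ R.gker.Factors (u ≫ T.arrow) := by
  rw [gker_factors_iff, ← zero_comp (f := T'.arrow), ← comp_mapSubQuot_iff hd, zero_comp]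

theorem imageSubobject_mapSubQuot_factors_iff (hd : S' ≤ R.defect) (hT₀ : R.dom ≤ T)
    {v : W ⟶ (T' : C)} :
    (imageSubobject (R.mapSubQuot h h' hS hT hS' hT')).Factors (v ≫ SubQuot.π h') ↔
      R.gim.Factors (v ≫ T'.arrow) := by
  rw [imageSubobject_factors_iff, gim_factors_iff]
  constructor
  · rintro ⟨W', ρ, _, x, hx⟩
    obtain ⟨W'', σ, _, u, hu⟩ := surjective_up_to_refinements_of_epi (SubQuot.π h) x
    have huv : u ≫ SubQuot.π h ≫ R.mapSubQuot h h' hS hT hS' hT' =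
        ((σ ≫ ρ) ≫ v) ≫ SubQuot.π h' := by
      rw [← reassoc_of% hu, ← hx, Category.assoc, Category.assoc]
    refine ⟨W'', σ ≫ ρ, inferInstance, u ≫ T.arrow, ?_⟩
    rw [← Category.assoc]
    exact (comp_mapSubQuot_iff hd).1 huv
  · rintro ⟨W', ρ, hρ, a, ha⟩
    obtain ⟨u, rfl⟩ : ∃ u : W' ⟶ (T : C), u ≫ T.arrow = a :=
      ⟨_, T.factorThru_arrow a (Subobject.factors_of_le _ hT₀ ha.dom_factors)⟩
    rw [← Category.assoc] at ha
    exact ⟨W', ρ, hρ, u ≫ SubQuot.π h, by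
      rw [Category.assoc, ha.comp_mapSubQuot, Category.assoc]⟩

theorem mapSubQuot_stableEquiv : (ofHom (R.mapSubQuot h h' hS hT hS' hT')).StableEquiv
    (((SubQuot.emb h).comp R).comp (SubQuot.proj h')) := by
  refine stableEquiv_iff.2 fun a b => ?_
  rw [locRelated_ofHom]
  constructor
  · rintro rfl
    obtain ⟨W₁, ρ, _, u, hu⟩ := surjective_up_to_refinements_of_epi (SubQuot.π h) a
    obtain ⟨W₂, σ, _, v, hv⟩ := exists_locRelated_arrow hT hT' u
    refine locRelated_comp.2 ⟨W₂, σ ≫ ρ, inferInstance, v ≫ T'.arrow, locRelated_comp.2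
      ⟨W₂, 𝟙 W₂, inferInstance, (σ ≫ u) ≫ T.arrow, SubQuot.locRelated_emb.2
        ⟨σ ≫ u, by simp [hu], rfl⟩, by rwa [Category.id_comp]⟩, SubQuot.locRelated_proj.2
          ⟨v, ?_, rfl⟩⟩
    rw [← hv.comp_mapSubQuot, Category.assoc, Category.assoc, reassoc_of% hu]
  · intro hab
    obtain ⟨W₁, ρ, _, y, hay, hyb⟩ := locRelated_comp.1 hab
    obtain ⟨v, hv, rfl⟩ := SubQuot.locRelated_proj.1 hyb
    obtain ⟨W₂, σ, _, x, hax, hxy⟩ := locRelated_comp.1 hay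
    obtain ⟨u, hu, rfl⟩ := SubQuot.locRelated_emb.1 hax
    rw [← Category.assoc] at hxy
    rw [← cancel_epi (σ ≫ ρ), Category.assoc σ ρ b, ← hv, ← Category.assoc σ,
      ← hxy.comp_mapSubQuot, reassoc_of% hu, Category.assoc]

theorem mapSubQuot_comp_mapSubQuot {R' : GenMor B D} {S'' T'' : Subobject D} {h'' : S'' ≤ T''}
    {hS₁ : S' ≤ R'.gker} {hT₁ : T' ≤ R'.dom} {hS'' : R'.defect ≤ S''} {hT'' : R'.gim ≤ T''}
    (hRR' : R.gim ≤ R'.gker) :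
    R.mapSubQuot h h' hS hT hS' hT' ≫ R'.mapSubQuot h' h'' hS₁ hT₁ hS'' hT'' = 0 := by
  obtain ⟨W, ρ, _, v, hv⟩ := exists_locRelated_arrow hT hT' (𝟙 (T : C))
  have hv0 : R'.LocRelated (v ≫ T'.arrow) ((0 : W ⟶ (T'' : C)) ≫ T''.arrow) := by
    rw [zero_comp, ← gker_factors_iff]
    exact Subobject.factors_of_le _ hRR' hv.gim_factors
  rw [← cancel_epi (SubQuot.π h), ← cancel_epi ρ, comp_zero, comp_zero]
  rw [Category.comp_id] at hv
  rw [reassoc_of% hv.comp_mapSubQuot, hv0.comp_mapSubQuot, zero_comp]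

end

end

section

variable {C : Type u} [Category.{v} C] [Abelian C] {A B D Z : C}

/-- Generalized embeddings: generalized morphisms that are defined everywhere and have trivial
generalized kernel. They exhibit their source as a subquotient of their target. -/
structure IsEmbedding (S : GenMor A B) : Prop where
  dom_eq_top : S.dom = ⊤
  gker_eq_bot : S.gker = ⊥

theorem dom_eq_top_iff {S : GenMor A B} : S.dom = ⊤ ↔ ∀ {W : C} (a : W ⟶ A),
    ∃ (W' : C) (π : W' ⟶ W) (_ : Epi π) (b : W' ⟶ B), S.LocRelated (π ≫ a) b := by
  simp only [← dom_factors_iff]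
  exact ⟨fun h W a => h ▸ Subobject.top_factors a,
    fun h => subobject_ext_of_factors_iff fun a => iff_of_true (h a) (Subobject.top_factors a)⟩

theorem gker_eq_bot_iff {S : GenMor A B} :
    S.gker = ⊥ ↔ ∀ {W : C} (a : W ⟶ A), S.LocRelated a 0 → a = 0 := by
  simp only [← gker_factors_iff, ← Subobject.bot_factors_iff_zero]
  exact ⟨fun h W a => h ▸ id,
    fun h => le_bot_iff.1 (Subobject.le_of_factors (h _ S.gker.factors_self))⟩

theorem isEmbedding_pinv_ofHom_comp_ofHom (e : Z ⟶ A) (m : Z ⟶ B) [Epi e] [Mono m] :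
    ((ofHom e).pinv.comp (ofHom m)).IsEmbedding where
  dom_eq_top := dom_eq_top_iff.2 fun a => by
    obtain ⟨W', π, hπ, z, hz⟩ := surjective_up_to_refinements_of_epi e a
    exact ⟨W', π, hπ, z ≫ m, locRelated_pinv_ofHom_comp_ofHom_iff.2 ⟨z, hz.symm, rfl⟩⟩
  gker_eq_bot := gker_eq_bot_iff.2 fun a ha => by
    obtain ⟨z, rfl, hz⟩ := locRelated_pinv_ofHom_comp_ofHom_iff.1 ha
    rw [zero_of_comp_mono m hz, zero_comp]

theorem IsEmbedding.comp {S : GenMor A B} {T : GenMor B D} (hS : S.IsEmbedding)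
    (hT : T.IsEmbedding) : (S.comp T).IsEmbedding where
  dom_eq_top := dom_eq_top_iff.2 fun a => by
    obtain ⟨W₁, π, _, b, hb⟩ := dom_eq_top_iff.1 hS.dom_eq_top a
    obtain ⟨W₂, ρ, _, c, hc⟩ := dom_eq_top_iff.1 hT.dom_eq_top b
    refine ⟨W₂, ρ ≫ π, inferInstance, c,
      locRelated_comp.2 ⟨W₂, 𝟙 W₂, inferInstance, ρ ≫ b, ?_, ?_⟩⟩
    · simpa using hb.precomp ρ
    · rwa [Category.id_comp]
  gker_eq_bot := gker_eq_bot_iff.2 fun a ha => by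
    obtain ⟨W', π, _, b, hab, hb⟩ := locRelated_comp.1 ha
    obtain rfl := gker_eq_bot_iff.1 hT.gker_eq_bot b (by rwa [comp_zero] at hb)
    rw [← cancel_epi π, comp_zero, gker_eq_bot_iff.1 hS.gker_eq_bot _ hab]

theorem IsEmbedding.exists_iso_subQuot {S : GenMor A B} (hS : S.IsEmbedding) {S' T' : Subobject B}
    (h : S' ≤ T') (hdefect : S.defect = S') (hgim : S.gim = T') :
    ∃ ψ : A ≅ SubQuot.obj h, S.StableEquiv ((ofHom ψ.hom).comp (SubQuot.emb h)) := by
  subst hdefect hgim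
  have : IsIso S.dom.arrow := (Subobject.isIso_arrow_iff_eq_top _).2 hS.dom_eq_top
  have : IsIso (SubQuot.π S.gker_le_dom) := SubQuot.isIso_π_of_eq_bot hS.gker_eq_bot
  refine ⟨(asIso S.dom.arrow).symm ≪≫ asIso (SubQuot.π S.gker_le_dom) ≪≫ S.coimageIsoImage,
    stableEquiv_iff.2 fun a b => ?_⟩
  rw [locRelated_ofHom_comp, SubQuot.locRelated_emb, locRelated_iff_exists_comp_coimageIsoImage]
  constructor
  · rintro ⟨u, v, rfl, rfl, h⟩
    exact ⟨v, by simp [← h], rfl⟩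
  · rintro ⟨v, hv, rfl⟩
    exact ⟨a ≫ inv S.dom.arrow, v, by simp, rfl, by simp [hv]⟩

end

end GenMor

section

variable {C : Type u} [Category.{v} C] [Abelian C] {κ : Type*} {c : ComplexShape κ}
  (P : HomologicalComplex C c)

theorem isEmbedding_homologyEmb (k : κ) : (homologyEmb P k).IsEmbedding :=
  GenMor.isEmbedding_pinv_ofHom_comp_ofHom _ _

theorem locRelated_homologyEmb {k : κ} {W : C} {a : W ⟶ P.homology k} {x : W ⟶ P.X k} :
    (homologyEmb P k).LocRelated a x ↔
      ∃ z : W ⟶ P.cycles k, z ≫ P.homologyπ k = a ∧ z ≫ P.iCycles k = x :=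
  GenMor.locRelated_pinv_ofHom_comp_ofHom_iff

theorem gim_homologyEmb {j k : κ} (hk : c.next j = k) :
    (homologyEmb P j).gim = kernelSubobject (P.d j k) :=
  subobject_ext_of_factors_iff fun x => by
    rw [kernelSubobject_factors_iff]
    constructor
    · intro hx
      obtain ⟨W', ρ, _, a, ha⟩ := GenMor.gim_factors_iff.1 hx
      obtain ⟨z, -, hz⟩ := (locRelated_homologyEmb P).1 ha
      rw [← cancel_epi ρ, ← reassoc_of% hz, P.iCycles_d, comp_zero, comp_zero]
    · intro hx
      exact ((locRelated_homologyEmb P).2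
        ⟨P.liftCycles x k hk hx, rfl, P.liftCycles_i x k hk hx⟩).gim_factors

theorem defect_homologyEmb {i j : κ} (hi : c.prev j = i) :
    (homologyEmb P j).defect = imageSubobject (P.d i j) :=
  subobject_ext_of_factors_iff fun x => by
    rw [GenMor.defect_factors_iff, locRelated_homologyEmb, imageSubobject_factors_iff]
    constructor
    · rintro ⟨z, hz, rfl⟩
      obtain ⟨W', ρ, hρ, y, hy⟩ :=
        (P.comp_homologyπ_eq_zero_iff_up_to_refinements i j hi z).1 hz
      exact ⟨W', ρ, hρ, y, by simpa using congrArg (· ≫ P.iCycles j) hy⟩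
    · rintro ⟨W', ρ, hρ, y, hy⟩
      have hx : x ≫ P.d j (c.next j) = 0 := by
        rw [← cancel_epi ρ, reassoc_of% hy, P.d_comp_d, comp_zero, comp_zero]
      refine ⟨P.liftCycles x _ rfl hx, ?_, P.liftCycles_i x _ rfl hx⟩
      refine (P.comp_homologyπ_eq_zero_iff_up_to_refinements i j hi _).2 ⟨W', ρ, hρ, y, ?_⟩
      rw [← cancel_mono (P.iCycles j)]
      simpa using hy

end

namespace SubQuot

section

variable {C : Type u} [Category.{v} C] [Abelian C] {X : C} {S T : Subobject X} (h : S ≤ T)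

theorem isEmbedding_emb : (emb h).IsEmbedding :=
  GenMor.isEmbedding_pinv_ofHom_comp_ofHom _ _

theorem gim_emb : (emb h).gim = T :=
  subobject_ext_of_factors_iff fun x => by
    refine ⟨fun hx => ?_, fun hx =>
      (locRelated_emb.2 ⟨T.factorThru x hx, rfl, T.factorThru_arrow x hx⟩).gim_factors⟩
    obtain ⟨W', ρ, _, a, ha⟩ := GenMor.gim_factors_iff.1 hx
    obtain ⟨b, -, hb⟩ := locRelated_emb.1 ha
    rw [← factors_epi_comp_iff T ρ, ← hb]
    exact Subobject.factors_comp_arrow b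

theorem defect_emb : (emb h).defect = S :=
  subobject_ext_of_factors_iff fun x => by
    simp only [GenMor.defect_factors_iff, locRelated_emb, comp_π_eq_zero_iff]
    refine ⟨fun ⟨_, hb, hbx⟩ => hbx ▸ hb, fun hx => ?_⟩
    have hT := T.factorThru_arrow x (Subobject.factors_of_le x h hx)
    exact ⟨_, hT.symm ▸ hx, hT⟩

theorem dom_proj : (proj h).dom = T :=
  subobject_ext_of_factors_iff fun x => by
    simp only [GenMor.dom_factors_iff, locRelated_proj, ← locRelated_emb,
      ← GenMor.gim_factors_iff, gim_emb]

theorem gker_proj : (proj h).gker = S :=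
  subobject_ext_of_factors_iff fun x => by
    rw [GenMor.gker_factors_iff, locRelated_proj, ← locRelated_emb, ← GenMor.defect_factors_iff,
      defect_emb]

end

end SubQuot

namespace FilteredCochainComplex

section

variable {C : Type u} [Category.{v} C] [Abelian C] (K : FilteredCochainComplex C)

theorem factors_comp_d {i i' : ℤ} (h : i + 1 = i') {j : ℤ} {W : C} {x : W ⟶ K.M.X i}
    (hx : (K.F j i).Factors x) : (K.F j i').Factors (x ≫ K.M.d i i') := by
  subst h
  rw [← Subobject.factorThru_arrow _ x hx, Category.assoc]
  exact Subobject.factors_of_factors_right _ (K.compat j i)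

theorem related_genD_iff {p q p' q' : ℤ} {W : C} {a : W ⟶ K.gr p q} {b : W ⟶ K.gr p' q'} :
    (K.genD p q p' q').Related a b ↔
      ∃ (x : W ⟶ (K.F p (p + q) : C)) (y : W ⟶ (K.F p' (p' + q') : C)),
        x ≫ SubQuot.π (K.le_succ p (p + q)) = a ∧ y ≫ SubQuot.π (K.le_succ p' (p' + q')) = b ∧
        (x ≫ (K.F p (p + q)).arrow) ≫ K.M.d (p + q) (p' + q') =
          y ≫ (K.F p' (p' + q')).arrow := by
  simp only [genD, emb, proj, GenMor.related_comp, SubQuot.related_emb, SubQuot.related_proj,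
    GenMor.related_ofHom]
  constructor
  · rintro ⟨_, ⟨_, ⟨x, rfl, rfl⟩, rfl⟩, y, hy, rfl⟩
    exact ⟨x, y, rfl, rfl, hy.symm⟩
  · rintro ⟨x, y, rfl, rfl, h⟩
    exact ⟨_, ⟨_, ⟨x, rfl, rfl⟩, rfl⟩, y, h.symm, rfl⟩

theorem dom_genD_eq_top {p q p' q' : ℤ} (hp : p' = p) (h : p + q + 1 = p' + q') :
    (K.genD p q p' q').dom = ⊤ := by
  subst hp
  refine GenMor.dom_eq_top_iff.2 fun a => ?_
  obtain ⟨W', ρ, hρ, x, hx⟩ :=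
    surjective_up_to_refinements_of_epi (SubQuot.π (K.le_succ p' (p' + q))) a
  have hxd := K.factors_comp_d h (Subobject.factors_comp_arrow x)
  exact ⟨W', ρ, hρ, _, (K.related_genD_iff.2
    ⟨x, Subobject.factorThru _ _ hxd, hx.symm, rfl, by simp⟩).locRelated⟩

theorem defect_genD_eq_bot {p q p' q' : ℤ} (hp : p = p') (h : p + q + 1 = p' + q') :
    (K.genD p q p' q').defect = ⊥ := by
  subst hp
  refine le_bot_iff.1 (Subobject.le_of_factors ?_)
  obtain ⟨W', ρ, _, hrel⟩ := GenMor.defect_factors_iff.1 (K.genD p q p q').defect.factors_self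
  obtain ⟨x, y, hx, hy, hxy⟩ := K.related_genD_iff.1 hrel
  rw [comp_zero, SubQuot.comp_π_eq_zero_iff] at hx
  rw [← factors_epi_comp_iff _ ρ, Subobject.bot_factors_iff_zero, ← hy,
    SubQuot.comp_π_eq_zero_iff, ← hxy]
  exact K.factors_comp_d h hx

theorem gker_genD_eq_dom {p q p' q' p'' q'' : ℤ} (hp : p' + 1 = p'')
    (h : p' + q' = p'' + q'') : (K.genD p q p' q').gker = (K.genD p q p'' q'').dom := by
  have key {n n' : ℤ} (hn : n = n') :
      (((K.emb p q).comp (GenMor.ofHom (K.M.d (p + q) n))).comp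
        (SubQuot.proj (K.le_succ p' n))).gker =
      (((K.emb p q).comp (GenMor.ofHom (K.M.d (p + q) n'))).comp
        (SubQuot.proj (K.le_succ p'' n'))).dom := by
    subst hn hp
    exact GenMor.gker_comp_eq_dom_comp _ ((SubQuot.gker_proj _).trans (SubQuot.dom_proj _).symm)
  exact key h

theorem gim_genD_eq_defect {p q p₀ q₀ p' q' : ℤ} (hp : p₀ + 1 = p) (h : p + q = p₀ + q₀) :
    (K.genD p q p' q').gim = (K.genD p₀ q₀ p' q').defect := by
  have key {n n₀ : ℤ} (hn : n = n₀) :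
      ((SubQuot.emb (K.le_succ p n)).comp
        ((GenMor.ofHom (K.M.d n (p' + q'))).comp (K.proj p' q'))).gim =
      ((SubQuot.emb (K.le_succ p₀ n₀)).comp
        ((GenMor.ofHom (K.M.d n₀ (p' + q'))).comp (K.proj p' q'))).defect := by
    subst hn hp
    exact GenMor.gim_comp_eq_defect_comp _ ((SubQuot.gim_emb _).trans (SubQuot.defect_emb _).symm)
  rw [genD, genD, (GenMor.comp_assoc_stableEquiv _ _ _).gim_eq,
    (GenMor.comp_assoc_stableEquiv _ _ _).defect_eq]
  exact key h

theorem dom_del_eq {r p q p' q' : ℤ} (hp : p + r = p') (hq : q - (r - 1) = q') :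
    (K.del r p q).dom = (K.genD p q p' q').dom := by
  subst hp hq
  rfl

/-- The differential `E_r^{p,q} ⟶ E_r^{p',q'}` for `p' = p + r` and `q' = q - (r - 1)`, induced by
the generalized differential. The target is kept independent, as in `genD`. -/
noncomputable def pageD (r p q p' q' : ℤ) (hp : p + r = p') (hq : q - (r - 1) = q') :
    K.page r p q ⟶ K.page r p' q' :=
  (K.genD p q p' q').mapSubQuot _ _
    ((K.delIn r p q).defect_le_gim.trans (K.gim_genD_le_gker_genD _ _ _ _ _ _))
    (K.dom_del_eq hp hq).le (K.genD_defect_congr p' q' (by lia) (by lia)).le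
    ((K.gim_genD_le_gker_genD _ _ _ _ _ _).trans (K.del r p' q').gker_le_dom)

theorem pageD_comp_pageD {r p q p' q' p'' q'' : ℤ} {hp : p + r = p'} {hq : q - (r - 1) = q'}
    {hp' : p' + r = p''} {hq' : q' - (r - 1) = q''} :
    K.pageD r p q p' q' hp hq ≫ K.pageD r p' q' p'' q'' hp' hq' = 0 :=
  GenMor.mapSubQuot_comp_mapSubQuot (K.gim_genD_le_gker_genD _ _ _ _ _ _)

theorem pageD_stableEquiv (r p q : ℤ) :
    (GenMor.ofHom (K.pageD r p q _ _ rfl rfl)).StableEquiv (K.pageDel r p q) := by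
  refine GenMor.mapSubQuot_stableEquiv.trans (GenMor.stableEquiv_of_related_iff fun a b => ?_)
  simp only [genD, pageDel, pageEmb, pageProj, pageEmbGr, pageProjGr, GenMor.related_comp]
  constructor
  · rintro ⟨y', ⟨x', hx', y, ⟨x, hx, hxy⟩, hy⟩, hy'⟩
    exact ⟨y, ⟨x, ⟨x', hx', hx⟩, hxy⟩, y', hy, hy'⟩
  · rintro ⟨y, ⟨x, ⟨x', hx', hx⟩, hxy⟩, y', hy, hy'⟩
    exact ⟨y', ⟨x', hx', y, ⟨x, hx, hxy⟩, hy⟩, hy'⟩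

/-- The page `E_r` as a complex. -/
noncomputable abbrev pageComplex (r : ℤ) :
    HomologicalComplex C (ComplexShape.up' (⟨r, 1 - r⟩ : ℤ × ℤ)) where
  X i := K.page r i.1 i.2
  d i j := if h : i.1 + r = j.1 ∧ i.2 - (r - 1) = j.2 then
    K.pageD r i.1 i.2 j.1 j.2 h.1 h.2 else 0
  shape i j h := dif_neg fun ⟨h₁, _⟩ => h (Prod.ext h₁ (by simp only [Prod.snd_add]; lia))
  d_comp_d' i j k _ _ := by
    split_ifs
    · exact K.pageD_comp_pageD
    all_goals simp

theorem pageComplex_d {r p q p' q' : ℤ} (hp : p + r = p') (hq : q - (r - 1) = q') :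
    (K.pageComplex r).d (p, q) (p', q') = K.pageD r p q p' q' hp hq :=
  dif_pos ⟨hp, hq⟩

theorem gim_homologyEmb_comp_pageEmbGr (r p q : ℤ) :
    ((homologyEmb (K.pageComplex r) (p, q)).comp (K.pageEmbGr r p q)).gim =
      (K.del r p q).gker :=
  SubQuot.gim_comp_emb_eq (K.del r p q).gker_le_dom fun b => by
    have hnext : (ComplexShape.up' (⟨r, 1 - r⟩ : ℤ × ℤ)).next (p, q) = (p + r, q - (r - 1)) :=
      ComplexShape.next_eq' _ (Prod.ext (by simp) (by simp; lia))
    rw [gim_homologyEmb _ hnext, K.pageComplex_d rfl rfl, kernelSubobject_factors_iff,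
      Category.assoc]
    exact GenMor.comp_mapSubQuot_eq_zero_iff (K.genD_defect_congr _ _ (by lia) (by lia)).ge

theorem defect_homologyEmb_comp_pageEmbGr (r p q : ℤ) :
    ((homologyEmb (K.pageComplex r) (p, q)).comp (K.pageEmbGr r p q)).defect =
      (K.delIn r p q).gim := by
  have hprev : (ComplexShape.up' (⟨r, 1 - r⟩ : ℤ × ℤ)).prev (p, q) = (p - r, q + (r - 1)) :=
    ComplexShape.prev_eq' _ (Prod.ext (by simp) (by simp; lia))
  have hd : (GenMor.ofHom (K.pageD r (p - r) (q + (r - 1)) p q (by lia) (by lia))).gim =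
      (homologyEmb (K.pageComplex r) (p, q)).defect := by
    rw [defect_homologyEmb _ hprev, K.pageComplex_d (by lia) (by lia)]
    rfl
  rw [← GenMor.gim_comp_eq_defect_comp _ hd]
  exact SubQuot.gim_comp_emb_eq
    ((K.delIn_gim_le_del_gker r p q).trans (K.del r p q).gker_le_dom) fun b =>
      GenMor.imageSubobject_mapSubQuot_factors_iff le_rfl (K.dom_del_eq (by lia) (by lia)).ge

theorem exists_homology_iso_page {r r' : ℤ} (h : r + 1 = r') (p q : ℤ) :
    ∃ ψ : (K.pageComplex r).homology (p, q) ≅ K.page r' p q,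
      ((homologyEmb (K.pageComplex r) (p, q)).comp (K.pageEmbGr r p q)).StableEquiv
        ((GenMor.ofHom ψ.hom).comp (K.pageEmbGr r' p q)) :=
  ((isEmbedding_homologyEmb _ _).comp (SubQuot.isEmbedding_emb _)).exists_iso_subQuot _
    ((K.defect_homologyEmb_comp_pageEmbGr r p q).trans
      (K.gim_genD_eq_defect (by lia) (by lia)))
    ((K.gim_homologyEmb_comp_pageEmbGr r p q).trans (K.gker_genD_eq_dom (by lia) (by lia)))

/-- The spectral sequence of a filtered cochain complex. -/
noncomputable abbrev spectralSequence : CohomologicalSpectralSequence C 0 where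
  page r _ := K.pageComplex r
  iso _ _ pq h _ := (K.exists_homology_iso_page h pq.1 pq.2).choose

end

end FilteredCochainComplex

theorem mainTheorem8 {C : Type u} [Category.{v} C] [Abelian C] (K : FilteredCochainComplex C) :
    -- the formula for `E_r^{p,q}` gives the graded part for `r = 0`
    (∀ p q : ℤ, (K.del 0 p q).dom = ⊤ ∧ (K.delIn 0 p q).defect = ⊥) ∧
    -- there is a cohomological spectral sequence starting at `0` with objects `E_r^{p,q}`
    ∃ (E : CohomologicalSpectralSequence C 0)
      (hX : ∀ (r : ℤ) (hr : 0 ≤ r) (p q : ℤ), (E.page r hr).X (p, q) = K.page r p q),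
      ∀ (r : ℤ) (hr : 0 ≤ r) (p q : ℤ),
        -- its differential `d_r^{p,q}` is the generalized morphism `emb · [∂] · proj` ...
        GenMor.StableEquiv
          (GenMor.ofHom (eqToHom (hX r hr p q).symm ≫
            (E.page r hr).d (p, q) (p + r, q - (r - 1)) ≫ eqToHom (hX r hr _ _)))
          (K.pageDel r p q) ∧
        -- ... and comes from `∂_r^{p,q}` by the generalized homomorphism theorem
        (∃ t : SubQuot.obj (K.del r p q).gker_le_dom ≅ SubQuot.obj (K.del r p q).defect_le_gim,
          GenMor.StableEquiv (K.del r p q)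
            (((SubQuot.proj (K.del r p q).gker_le_dom).comp (GenMor.ofHom t.hom)).comp
              (SubQuot.emb (K.del r p q).defect_le_gim)) ∧
          eqToHom (hX r hr p q).symm ≫
              (E.page r hr).d (p, q) (p + r, q - (r - 1)) ≫ eqToHom (hX r hr _ _) =
            K.pageToCoim r p q ≫ t.hom ≫ K.imToPage r p q) ∧
        -- the isomorphism `H(E_r) ≅ E_{r+1}` identifies them as subquotients of the graded part
        GenMor.StableEquiv
          (((homologyEmb (E.page r hr) (p, q)).comp
            (GenMor.ofHom (eqToHom (hX r hr p q)))).comp (K.pageEmbGr r p q))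
          ((GenMor.ofHom ((E.iso r (r + 1) (p, q) rfl hr).hom ≫
            eqToHom (hX (r + 1) (by lia) p q))).comp (K.pageEmbGr (r + 1) p q)) := by
  refine ⟨fun p q => ⟨K.dom_genD_eq_top (by lia) (by lia), K.defect_genD_eq_bot (by lia) (by lia)⟩,
    K.spectralSequence, fun _ _ _ _ => rfl, fun r hr p q => ?_⟩
  have hd : (K.spectralSequence.page r hr).d (p, q) (p + r, q - (r - 1)) =
      K.pageD r p q _ _ rfl rfl := K.pageComplex_d rfl rfl
  rw [hd]
  simp only [eqToHom_refl, Category.id_comp, Category.comp_id]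
  refine ⟨K.pageD_stableEquiv r p q, ⟨(K.del r p q).coimageIsoImage,
    (K.del r p q).coimageIsoImage_stableEquiv, rfl⟩, ?_⟩
  exact (GenMor.StableEquiv.comp (GenMor.comp_ofHom_id_stableEquiv _) rfl).trans
    (K.exists_homology_iso_page rfl p q).choose_spec
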